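/- **Theorem (Full Trakhtenbrot).** An instance of the binary Post correspondence problem is a finite list $R$ of pairs $s/t$ of Boolean strings. Derivability $R\triangleright s/t$ is defined inductively: $R\triangleright s/t$ whenever $s/t\in R$, and $R\triangleright su/tv$ whenever $s/t\in R$ and $R\triangleright u/v$. Then $\mathsf{BPCP}(R)$ means that $R\triangleright s/s$ for some string $s$. A signature $\Sigma$ consists of arbitrary sets of function symbols and of relation symbols, each symbol having an arity in $\mathbb N$. Terms are built from variables $x_0,x_1,\dots$ and function symbols; formulas are built from $\bot$ and atoms $P(t_1,\dots,t_n)$ by $\to,\wedge,\vee,\forall,\exists$; there is no built-in equality. For a formula $\varphi$ over $\Sigma$, $\mathsf{FSAT}(\Sigma)(\varphi)$ means that $\varphi$ holds, in the usual Tarski semantics, in some $\Sigma$-structure with finite domain under some assignment of its variables. A function $R\mapsto\varphi_R$ from instances to formulas over $\Sigma$ is called computable if only finitely many symbols of $\Sigma$ occur in the formulas $\varphi_R$ altogether and, for every assignment of natural numbers to the symbols (injective or not), the word over $\mathbb N$ that spells out $\varphi_R$ in prefix notation, each symbol being written as its number, is a (Turing) computable function of $R$. Let $\Sigma$ be a signature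 such that either (a) $\Sigma$ contains a relation symbol of arity at least $2$, or (b) $\Sigma$ contains a relation symbol of arity exactly $1$ and a function symbol of arity at least $2$. Then $\mathsf{BPCP}$ many-one reduces to $\mathsf{FSAT}(\Sigma)$: there is a computable function $R\mapsto\varphi_R$ from instances to formulas over $\Sigma$ such that, for every instance $R$, $$\mathsf{BPCP}(R)\iff \mathsf{FSAT}(\Sigma)(\varphi_R).$$ -/

import Mathlib

universe u v

namespace Trakhtenbrot

/-! ### The binary Post correspondence problem -/

/-- An instance: a finite list of pairs (cards) of Boolean strings. -/
abbrev Instance : Type := List (List Bool × List Bool)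

/-- Derivability of a pair of strings from the instance `R`. -/
inductive Derivable (R : Instance) : List Bool → List Bool → Prop
  | base {s t : List Bool} : (s, t) ∈ R → Derivable R s t
  | step {s t u v : List Bool} : (s, t) ∈ R → Derivable R u v → Derivable R (s ++ u) (t ++ v)

/-- The instance `R` is solvable. -/
def BPCP (R : Instance) : Prop := ∃ s : List Bool, Derivable R s s

/-! ### First-order logic without built-in equality -/

/-- A first-order signature: arbitrary types of function and relation symbols, with arities. -/
structure Signature where
  Func : Type u
  Rel : Type v
  arF : Func → ℕ
  arR : Rel → ℕ

/-- Terms, with variables `0, 1, 2, …`. -/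
inductive Term (S : Signature.{u, v}) : Type u
  | var : ℕ → Term S
  | app : (f : S.Func) → (Fin (S.arF f) → Term S) → Term S

/-- Formulas, with de Bruijn binding. -/
inductive Form (S : Signature.{u, v}) : Type (max u v)
  | bot : Form S
  | rel : (P : S.Rel) → (Fin (S.arR P) → Term S) → Form S
  | imp : Form S → Form S → Form S
  | and : Form S → Form S → Form S
  | or : Form S → Form S → Form S
  | all : Form S → Form S
  | ex : Form S → Form S

/-- Interpretation of all the symbols of a signature over a domain `D`. -/
structure Model (S : Signature.{u, v}) (D : Type) where
  func : (f : S.Func) → (Fin (S.arF f) → D) → D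
  rel : (P : S.Rel) → (Fin (S.arR P) → D) → Prop

/-- De Bruijn extension of an assignment: `0 ↦ a` and `x + 1 ↦ ρ x`. -/
def extend {D : Type} (a : D) (ρ : ℕ → D) : ℕ → D
  | 0 => a
  | x + 1 => ρ x

/-- Evaluation of terms. -/
def Term.eval {S : Signature.{u, v}} {D : Type} (M : Model S D) (ρ : ℕ → D) : Term S → D
  | .var x => ρ x
  | .app f ts => M.func f (fun i => (ts i).eval M ρ)

/-- Tarski satisfaction. -/
def Form.Sat {S : Signature.{u, v}} {D : Type} (M : Model S D) : (ℕ → D) → Form S → Prop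
  | _, .bot => False
  | ρ, .rel P ts => M.rel P (fun i => (ts i).eval M ρ)
  | ρ, .imp φ ψ => φ.Sat M ρ → ψ.Sat M ρ
  | ρ, .and φ ψ => φ.Sat M ρ ∧ ψ.Sat M ρ
  | ρ, .or φ ψ => φ.Sat M ρ ∨ ψ.Sat M ρ
  | ρ, .all φ => ∀ a : D, φ.Sat M (extend a ρ)
  | ρ, .ex φ => ∃ a : D, φ.Sat M (extend a ρ)

/-- Finite satisfiability: some finite domain, interpretation and assignment satisfy `φ`.
Every finite type is in bijection with one in `Type`, so the universe of `D` is no restriction.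
Decidability of the relations of the model holds automatically in classical logic. -/
def FSAT (S : Signature.{u, v}) (φ : Form S) : Prop :=
  ∃ (D : Type) (_ : Finite D) (M : Model S D) (ρ : ℕ → D), φ.Sat M ρ

/-! ### Computable formula-valued functions and many-one reductions -/

/-- Function symbols occurring in a term. -/
def Term.funcs {S : Signature.{u, v}} : Term S → Set S.Func
  | .var _ => ∅
  | .app f ts => {f} ∪ ⋃ i, (ts i).funcs

/-- Function symbols occurring in a formula. -/
def Form.funcs {S : Signature.{u, v}} : Form S → Set S.Func
  | .bot => ∅
  | .rel _ ts => ⋃ i, (ts i).funcs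
  | .imp φ ψ => φ.funcs ∪ ψ.funcs
  | .and φ ψ => φ.funcs ∪ ψ.funcs
  | .or φ ψ => φ.funcs ∪ ψ.funcs
  | .all φ => φ.funcs
  | .ex φ => φ.funcs

/-- Relation symbols occurring in a formula. -/
def Form.rels {S : Signature.{u, v}} : Form S → Set S.Rel
  | .bot => ∅
  | .rel P _ => {P}
  | .imp φ ψ => φ.rels ∪ ψ.rels
  | .and φ ψ => φ.rels ∪ ψ.rels
  | .or φ ψ => φ.rels ∪ ψ.rels
  | .all φ => φ.rels
  | .ex φ => φ.rels

/-- A term written out as a word of natural numbers in prefix (Polish) notation, where the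
function symbol `f` is written as the number `cF f`. -/
def Term.word {S : Signature.{u, v}} (cF : S.Func → ℕ) : Term S → List ℕ
  | .var x => [0, x]
  | .app f ts => 1 :: cF f :: (List.ofFn (fun i => (ts i).word cF)).flatten

/-- A formula written out as a word of natural numbers in prefix (Polish) notation, where the
function symbol `f` and the relation symbol `P` are written as the numbers `cF f` and `cR P`.
The formula can be read off its word as soon as `cF` and `cR` are injective on the symbols that
may occur. -/
def Form.word {S : Signature.{u, v}} (cF : S.Func → ℕ) (cR : S.Rel → ℕ) : Form S → List ℕ
  | .bot => [0]
  | .rel P ts => 1 :: cR P :: (List.ofFn (fun i => (ts i).word cF)).flatten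
  | .imp φ ψ => 2 :: (φ.word cF cR ++ ψ.word cF cR)
  | .and φ ψ => 3 :: (φ.word cF cR ++ ψ.word cF cR)
  | .or φ ψ => 4 :: (φ.word cF cR ++ ψ.word cF cR)
  | .all φ => 5 :: φ.word cF cR
  | .ex φ => 6 :: φ.word cF cR

/-- A formula-valued function is computable. The signature is an arbitrary pair of types, with no
given coding of its symbols; so the notion asks that all the values of `g` be formulas in finitely
many symbols, and that, however these symbols are numbered, the word spelling out `g x` be computed
from `x` by a (Turing) computable function. -/
def ComputableForm {X : Type*} [Primcodable X] {S : Signature.{u, v}} (g : X → Form S) : Prop :=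
  (⋃ x, (g x).funcs).Finite ∧ (⋃ x, (g x).rels).Finite ∧
    ∀ (cF : S.Func → ℕ) (cR : S.Rel → ℕ), Computable (fun x => (g x).word cF cR)

/-- Many-one reducibility of a problem on `X` to a problem on formulas. -/
def ReducesTo {X : Type*} [Primcodable X] {S : Signature.{u, v}}
    (p : X → Prop) (q : Form S → Prop) : Prop :=
  ∃ g : X → Form S, ComputableForm g ∧ ∀ x, p x ↔ q (g x)

end Trakhtenbrot

/-!
The reduction describes a solution of `R` by a finite directed graph, so that it needs only one
binary relation `E` and no equality.

If `w` solves `R`, then every pair met while a derivation of `w / w` is taken apart consists of two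
suffixes of `w`, hence is given by two positions in `w`. So it is enough to have a graph containing
the positions of `w` in their order, the letters of `w`, and a binary relation on positions, that of
being derivable. In `WordGraph` the positions are the vertices with a loop, and `E` orders them; a
letter is `true` if the position has an edge to the one vertex without outgoing edges; and each
position `j` has a loopless companion whose edges link it from the positions `i` that
are related to `j`, and to `j` itself (`Linked`). The sentence `solvable R` says that the looped
vertices are totally preordered, that the letters respect the preorder, that some position is linked
to itself, and that from any linked pair of positions one can read a card of `R` so as to arrive
either at a linked pair or at the end on both sides.

A finite graph satisfying the sentence yields a derivation. Unless `R` has the empty card, which is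
itself a solution, every card read brings us closer to the end, so induction on the number
of later positions derives a pair of words read from two linked positions
(`IsPreordered.exists_derivable`); and the word read from a position up to the end is unique
(`IsPreordered.path_unique`), so that a self-linked position gives a solution.

Finally, an atom `P(x, y, …, y)` or `Q(f(x, y, …, y))` can express any binary relation on a domain
with at least two elements; in the second case, `f` takes only two values, which `Q` tells apart.
The word of the resulting formula is primitive recursive in `R`: cards of unbounded length enter
only through `GForm.walkFrom`, whose word is a concatenation of pieces depending on one letter each.
-/

namespace Trakhtenbrot

/-! ### Formulas about a directed graph -/

/-- Formulas with de Bruijn binding in the signature of one binary relation. -/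
inductive GForm : Type
  | bot : GForm
  | adj : ℕ → ℕ → GForm
  | imp : GForm → GForm → GForm
  | and : GForm → GForm → GForm
  | or : GForm → GForm → GForm
  | all : GForm → GForm
  | ex : GForm → GForm

namespace GForm

/-- Tarski satisfaction in the graph `E`. -/
def Sat {D : Type} (E : D → D → Prop) : (ℕ → D) → GForm → Prop
  | _, .bot => False
  | ρ, .adj i j => E (ρ i) (ρ j)
  | ρ, .imp φ ψ => φ.Sat E ρ → ψ.Sat E ρ
  | ρ, .and φ ψ => φ.Sat E ρ ∧ ψ.Sat E ρ
  | ρ, .or φ ψ => φ.Sat E ρ ∨ ψ.Sat E ρ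
  | ρ, .all φ => ∀ a : D, φ.Sat E (extend a ρ)
  | ρ, .ex φ => ∃ a : D, φ.Sat E (extend a ρ)

/-- The formula over `S` obtained by reading `adj i j` as the formula `A i j`. No renaming of
variables is involved: `A i j` is meant to be quantifier-free in the variables `i` and `j`. -/
def toForm {S : Signature.{u, v}} (A : ℕ → ℕ → Form S) : GForm → Form S
  | .bot => .bot
  | .adj i j => A i j
  | .imp φ ψ => .imp (φ.toForm A) (ψ.toForm A)
  | .and φ ψ => .and (φ.toForm A) (ψ.toForm A)
  | .or φ ψ => .or (φ.toForm A) (ψ.toForm A)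
  | .all φ => .all (φ.toForm A)
  | .ex φ => .ex (φ.toForm A)

theorem sat_toForm {S : Signature.{u, v}} {A : ℕ → ℕ → Form S} {D : Type} {M : Model S D}
    {E : D → D → Prop} (h : ∀ ρ i j, (A i j).Sat M ρ ↔ E (ρ i) (ρ j)) (φ : GForm) (ρ : ℕ → D) :
    (φ.toForm A).Sat M ρ ↔ φ.Sat E ρ := by
  induction φ generalizing ρ <;> simp_all [toForm, Form.Sat, Sat]

theorem funcs_toForm {S : Signature.{u, v}} {A : ℕ → ℕ → Form S} {F : Set S.Func}
    (h : ∀ i j, (A i j).funcs ⊆ F) (φ : GForm) : (φ.toForm A).funcs ⊆ F := by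
  induction φ <;> simp_all [toForm, Form.funcs]

theorem rels_toForm {S : Signature.{u, v}} {A : ℕ → ℕ → Form S} {F : Set S.Rel}
    (h : ∀ i j, (A i j).rels ⊆ F) (φ : GForm) : (φ.toForm A).rels ⊆ F := by
  induction φ <;> simp_all [toForm, Form.rels]

end GForm

@[simp] theorem extend_zero {D : Type} (a : D) (ρ : ℕ → D) : extend a ρ 0 = a := rfl

@[simp] theorem extend_succ {D : Type} (a : D) (ρ : ℕ → D) (i : ℕ) :
    extend a ρ (i + 1) = ρ i := rfl

/-! ### Words in a directed graph -/

namespace WordGraph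

variable {D : Type} (E : D → D → Prop)

/-- Two vertices are the same position. Positions are the vertices with a loop. -/
def Equiv (x y : D) : Prop := E x x ∧ E y y ∧ E x y ∧ E y x

/-- The position `x` comes strictly before the position `y`. -/
def Lt (x y : D) : Prop := E x x ∧ E y y ∧ ¬ E y x

/-- The position `y` comes immediately after the position `x`. -/
def Next (x y : D) : Prop := Lt E x y ∧ ∀ z, Lt E x z → ¬ Lt E z y

/-- The letter at `x` is `true`: there is an edge from `x` to a vertex without outgoing edges. -/
def Marked (x : D) : Prop := ∃ b, E x b ∧ ∀ y, ¬ E b y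

/-- The letter at `x` is `b`. -/
def Letter (b : Bool) (x : D) : Prop := if b then Marked E x else ¬ Marked E x

/-- The relation on positions that stands for derivability: `x` is joined to `y` through
a loopless vertex. -/
def Linked (x y : D) : Prop := E x x ∧ E y y ∧ ∃ b, ¬ E b b ∧ E x b ∧ E b y

/-- The position `x` is the last one. -/
def Last (x : D) : Prop := E x x ∧ ∀ z, ¬ Lt E x z

/-- Reading the word `s` from the position `x` leads to the position `y`. -/
def Path : List Bool → D → D → Prop
  | [], x, y => Equiv E x y
  | b :: s, x, y => ∃ z, (Next E x z ∧ Letter E b x) ∧ Path s z y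

/-- The edge relation is a total preorder on positions, and equivalent positions have the same
letter. -/
structure IsPreordered : Prop where
  trans : ∀ x y z, E x x → E y y → E z z → E x y → E y z → E x z
  total : ∀ x y, E x x → E y y → E x y ∨ E y x
  marked : ∀ x y, Equiv E x y → Marked E x → Marked E y

/-- The two words of the card `c` can be read from the positions `x` and `y` so as to arrive at linked
positions or at the end on both sides. The positions equivalent to `x` and `y` allow `GForm.walkFrom`
to have a fixed initial variable. -/
def Move (c : List Bool × List Bool) (x y : D) : Prop :=
  ∃ x' y', ((∃ a, Equiv E a x ∧ Path E c.1 a x') ∧ (∃ a, Equiv E a y ∧ Path E c.2 a y')) ∧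
    (Linked E x' y' ∨ Last E x' ∧ Last E y')

/-- The graph describes a solution of `R`. -/
structure Solves (R : Instance) : Prop extends IsPreordered E where
  start : ∃ x, Linked E x x
  move : ∀ x y, Linked E x y → ∃ c ∈ R, Move E c x y

variable {E}

theorem Equiv.symm {x y : D} (h : Equiv E x y) : Equiv E y x := ⟨h.2.1, h.1, h.2.2.2, h.2.2.1⟩

theorem equiv_of_next {x y z : D} (h : Next E x y) (h' : Next E x z) : Equiv E y z :=
  ⟨h.1.2.1, h'.1.2.1, not_not.1 fun hn => h.2 _ h'.1 ⟨h'.1.2.1, h.1.2.1, hn⟩,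
    not_not.1 fun hn => h'.2 _ h.1 ⟨h.1.2.1, h'.1.2.1, hn⟩⟩

namespace IsPreordered

variable (hE : IsPreordered E)
include hE

theorem lt_trans {x y z : D} (h : Lt E x y) (h' : Lt E y z) : Lt E x z :=
  ⟨h.1, h'.2.1, fun hzx => h'.2.2 (hE.trans _ _ _ h'.2.1 h.1 h.2.1 hzx
    ((hE.total _ _ h.1 h.2.1).resolve_right h.2.2))⟩

theorem lt_congr_left {x x' y : D} (h : Equiv E x x') (hy : Lt E x y) : Lt E x' y :=
  ⟨h.2.1, hy.2.1, fun hyx => hy.2.2 (hE.trans _ _ _ hy.2.1 h.2.1 h.1 hyx h.2.2.2)⟩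

theorem equiv_trans {x y z : D} (h : Equiv E x y) (h' : Equiv E y z) : Equiv E x z :=
  ⟨h.1, h'.2.1, hE.trans _ _ _ h.1 h.2.1 h'.2.1 h.2.2.1 h'.2.2.1,
    hE.trans _ _ _ h'.2.1 h.2.1 h.1 h'.2.2.2 h.2.2.2⟩

theorem letter_congr {x x' : D} {b : Bool} (h : Equiv E x x') (hx : Letter E b x) :
    Letter E b x' := by
  cases b
  · exact fun hm => hx (hE.marked _ _ h.symm hm)
  · exact hE.marked _ _ h hx

theorem path_congr_left {s : List Bool} {x x' y : D} (h : Equiv E x x') (hp : Path E s x y) :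
    Path E s x' y := by
  cases s with
  | nil => exact hE.equiv_trans h.symm hp
  | cons b s =>
    obtain ⟨z, ⟨hn, hl⟩, hz⟩ := hp
    exact ⟨z, ⟨⟨hE.lt_congr_left h hn.1, fun u hu => hn.2 u (hE.lt_congr_left h.symm hu)⟩,
      hE.letter_congr h hl⟩, hz⟩

theorem path_append {s t : List Bool} {x y z : D} (h : Path E s x y) (h' : Path E t y z) :
    Path E (s ++ t) x z := by
  induction s generalizing x with
  | nil => exact hE.path_congr_left h.symm h'
  | cons b s ih =>
    obtain ⟨u, hu, hp⟩ := h
    exact ⟨u, hu, ih hp⟩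

/-- The word read from a position up to the end is unique. -/
theorem path_unique {s t : List Bool} {x e f : D} (hs : Path E s x e) (he : Last E e)
    (ht : Path E t x f) (hf : Last E f) : s = t := by
  induction s generalizing t x with
  | nil =>
    cases t with
    | nil => rfl
    | cons c t =>
      obtain ⟨z, ⟨hn, -⟩, -⟩ := ht
      exact (he.2 z (hE.lt_congr_left hs hn.1)).elim
  | cons b s ih =>
    cases t with
    | nil =>
      obtain ⟨z, ⟨hn, -⟩, -⟩ := hs
      exact (hf.2 z (hE.lt_congr_left ht hn.1)).elim
    | cons c t =>
      obtain ⟨z, ⟨hn, hl⟩, hz⟩ := hs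
      obtain ⟨z', ⟨hn', hl'⟩, hz'⟩ := ht
      have hbc : b = c := by
        cases b <;> cases c <;> simp_all [Letter]
      rw [hbc, ih hz (hE.path_congr_left (equiv_of_next hn' hn) hz')]

/-- Reading a word lowers the number of later positions at least by the length of the word. -/
theorem ncard_lt_of_path [Finite D] {s : List Bool} {x y : D} (h : Path E s x y) :
    {z | Lt E y z}.ncard + s.length ≤ {z | Lt E x z}.ncard := by
  induction s generalizing x with
  | nil => exact Set.ncard_le_ncard (fun z hz => hE.lt_congr_left h.symm hz) (Set.toFinite _)
  | cons b s ih =>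
    obtain ⟨u, ⟨hn, -⟩, hp⟩ := h
    have hlt : {z | Lt E u z}.ncard < {z | Lt E x z}.ncard := by
      refine Set.ncard_lt_ncard ⟨fun z hz => hE.lt_trans hn.1 hz, fun hsub => ?_⟩ (Set.toFinite _)
      have hu : Lt E u u := hsub hn.1
      exact hu.2.2 hu.1
    have := ih hp
    rw [List.length_cons]
    omega

/-- The words read from two linked positions to the end can be chosen derivable. The empty card is
excluded as reading it makes no progress, so that the induction on the number of later positions
would break down. -/
theorem exists_derivable [Finite D] {R : Instance} (hR : ([], []) ∉ R)
    (hmove : ∀ x y, Linked E x y → ∃ c ∈ R, Move E c x y) (n : ℕ) (x y : D)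
    (hn : {z | Lt E x z}.ncard + {z | Lt E y z}.ncard ≤ n) (h : Linked E x y) :
    ∃ s t e f, Derivable R s t ∧ (Path E s x e ∧ Last E e) ∧ (Path E t y f ∧ Last E f) := by
  induction n using Nat.strong_induction_on generalizing x y with
  | _ n ih =>
    obtain ⟨⟨s, t⟩, hc, x', y', ⟨⟨a, ha, hs⟩, b, hb, ht⟩, hxy⟩ := hmove x y h
    replace hs := hE.path_congr_left ha hs
    replace ht := hE.path_congr_left hb ht
    rcases hxy with hxy | ⟨hx, hy⟩
    · have h₁ := hE.ncard_lt_of_path hs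
      have h₂ := hE.ncard_lt_of_path ht
      have hpos : 0 < s.length + t.length := by
        by_contra h0
        have hs0 : s = [] := List.length_eq_zero_iff.1 (by omega)
        have ht0 : t = [] := List.length_eq_zero_iff.1 (by omega)
        rw [hs0, ht0] at hc
        exact hR hc
      dsimp only at h₁ h₂
      obtain ⟨u, v, e, f, hd, ⟨hu, he⟩, hv, hf⟩ := ih _ (by omega) x' y' le_rfl hxy
      exact ⟨s ++ u, t ++ v, e, f, .step hc hd, ⟨hE.path_append hs hu, he⟩,
        hE.path_append ht hv, hf⟩
    · exact ⟨s, t, x', y', .base hc, ⟨hs, hx⟩, ht, hy⟩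

end IsPreordered

theorem Solves.bpcp [Finite D] {R : Instance} (h : Solves E R) : BPCP R := by
  by_cases hR : ([], []) ∈ R
  · exact ⟨[], .base hR⟩
  · obtain ⟨x, hx⟩ := h.start
    obtain ⟨s, t, e, f, hd, ⟨hs, he⟩, ht, hf⟩ :=
      h.toIsPreordered.exists_derivable hR h.move _ x x le_rfl hx
    obtain rfl := h.toIsPreordered.path_unique hs he ht hf
    exact ⟨s, hd⟩

/-! ### The graph of a solution -/

/-- The vertices of the graph of the word `w`: the positions `inl i`, where the last one is
the end of the word; for each position `j` its companion `inr (some j)`; and the mark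
`inr none`. -/
abbrev Vertex (w : List Bool) : Type := Fin (w.length + 1) ⊕ Option (Fin (w.length + 1))

/-- The graph of the word `w`, in which positions are linked when the suffixes starting there are
derivable. -/
def edge (R : Instance) (w : List Bool) : Vertex w → Vertex w → Prop
  | .inl i, .inl j => i ≤ j
  | .inl i, .inr none => w[(i : ℕ)]? = some true
  | .inl i, .inr (some j) => Derivable R (w.drop i) (w.drop j)
  | .inr (some j), .inl i => i = j
  | .inr none, .inl _ => False
  | .inr _, .inr _ => False

section edge

variable {R : Instance} {w : List Bool}

theorem edge_self_iff {x : Vertex w} : edge R w x x ↔ ∃ i, x = .inl i := by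
  rcases x with i | _ | j <;> simp [edge]

theorem lt_edge_iff {i j : Fin (w.length + 1)} :
    Lt (edge R w) (.inl i) (.inl j) ↔ i < j := by
  simp [Lt, edge]

theorem marked_edge_iff {i : Fin (w.length + 1)} :
    Marked (edge R w) (.inl i) ↔ w[(i : ℕ)]? = some true := by
  constructor
  · rintro ⟨j | _ | j, h, hb⟩
    · exact (hb (.inl j) (le_refl j)).elim
    · exact h
    · exact (hb (.inl j) rfl).elim
  · intro h
    refine ⟨.inr none, h, ?_⟩
    rintro (j | _ | j) <;> simp [edge]

theorem linked_edge_iff {x y : Vertex w} : Linked (edge R w) x y ↔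
    ∃ i j, x = .inl i ∧ y = .inl j ∧ Derivable R (w.drop i) (w.drop j) := by
  constructor
  · rintro ⟨hx, hy, b, hb, hxb, hby⟩
    obtain ⟨i, rfl⟩ := edge_self_iff.1 hx
    obtain ⟨j, rfl⟩ := edge_self_iff.1 hy
    rcases b with k | _ | k
    · exact (hb (le_refl k)).elim
    · exact hby.elim
    · obtain rfl : j = k := hby
      exact ⟨i, j, rfl, rfl, hxb⟩
  · rintro ⟨i, j, rfl, rfl, h⟩
    exact ⟨le_refl i, le_refl j, .inr (some j), id, h, rfl⟩

theorem last_edge : Last (edge R w) (.inl (Fin.last w.length)) := by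
  refine ⟨le_refl (Fin.last w.length), fun z hz => ?_⟩
  obtain ⟨j, rfl⟩ := edge_self_iff.1 hz.2.1
  exact (Fin.le_last j).not_gt (lt_edge_iff.1 hz)

theorem equiv_edge_refl (i : Fin (w.length + 1)) : Equiv (edge R w) (.inl i) (.inl i) :=
  ⟨le_refl i, le_refl i, le_refl i, le_refl i⟩

/-- A prefix of the suffix starting at `i` can be read from `i`, and what is left is the suffix
starting at the position where it ends. -/
theorem path_edge {s u : List Bool} {i : Fin (w.length + 1)} (h : w.drop i = s ++ u) :
    ∃ j : Fin (w.length + 1), Path (edge R w) s (.inl i) (.inl j) ∧ w.drop j = u := by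
  induction s generalizing i with
  | nil => exact ⟨i, equiv_edge_refl i, h⟩
  | cons b s ih =>
    have hlt : (i : ℕ) < w.length := by
      by_contra hn
      rw [List.drop_eq_nil_of_le (by omega)] at h
      simp at h
    rw [List.drop_eq_getElem_cons hlt, List.cons_append, List.cons.injEq] at h
    obtain ⟨j, hj, hu⟩ := ih (i := ⟨i + 1, by omega⟩) h.2
    refine ⟨j, ⟨_, ⟨⟨lt_edge_iff.2 (Fin.lt_def.2 (Nat.lt_succ_self _)), fun z hz hz' => ?_⟩, ?_⟩,
      hj⟩, hu⟩
    · obtain ⟨k, rfl⟩ := edge_self_iff.1 hz.2.1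
      have h₁ := Fin.lt_def.1 (lt_edge_iff.1 hz)
      have h₂ := Fin.lt_def.1 (lt_edge_iff.1 hz')
      dsimp only at h₂
      omega
    · have hb : w[(i : ℕ)]? = some b := by rw [List.getElem?_eq_getElem hlt, h.1]
      cases b <;> simp [Letter, marked_edge_iff, hb]

theorem solves_edge (h : Derivable R w w) : Solves (edge R w) R where
  trans x y z hx hy hz hxy hyz := by
    obtain ⟨i, rfl⟩ := edge_self_iff.1 hx
    obtain ⟨j, rfl⟩ := edge_self_iff.1 hy
    obtain ⟨k, rfl⟩ := edge_self_iff.1 hz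
    exact le_trans (α := Fin (w.length + 1)) hxy hyz
  total x y hx hy := by
    obtain ⟨i, rfl⟩ := edge_self_iff.1 hx
    obtain ⟨j, rfl⟩ := edge_self_iff.1 hy
    exact le_total i j
  marked x y hxy hm := by
    obtain ⟨i, rfl⟩ := edge_self_iff.1 hxy.1
    obtain ⟨j, rfl⟩ := edge_self_iff.1 hxy.2.1
    obtain rfl : i = j := le_antisymm hxy.2.2.1 hxy.2.2.2
    exact hm
  start := ⟨.inl 0, linked_edge_iff.2 ⟨0, 0, rfl, rfl, by simpa using h⟩⟩
  move x y hxy := by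
    obtain ⟨i, j, rfl, rfl, hd⟩ := linked_edge_iff.1 hxy
    generalize hu : w.drop i = u at hd
    generalize hv : w.drop j = v at hd
    cases hd with
    | base hc =>
      obtain ⟨i', hi, hi'⟩ := path_edge (R := R) (hu.trans (List.append_nil _).symm)
      obtain ⟨j', hj, hj'⟩ := path_edge (R := R) (hv.trans (List.append_nil _).symm)
      obtain rfl : i' = Fin.last _ := Fin.ext (by rw [List.drop_eq_nil_iff] at hi'; simp; omega)
      obtain rfl : j' = Fin.last _ := Fin.ext (by rw [List.drop_eq_nil_iff] at hj'; simp; omega)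
      exact ⟨_, hc, _, _, ⟨⟨_, equiv_edge_refl i, hi⟩, _, equiv_edge_refl j, hj⟩,
        .inr ⟨last_edge, last_edge⟩⟩
    | step hc hd =>
      obtain ⟨i', hi, rfl⟩ := path_edge (R := R) hu
      obtain ⟨j', hj, rfl⟩ := path_edge (R := R) hv
      exact ⟨_, hc, _, _, ⟨⟨_, equiv_edge_refl i, hi⟩, _, equiv_edge_refl j, hj⟩,
        .inl (linked_edge_iff.2 ⟨i', j', rfl, rfl, hd⟩)⟩

end edge

end WordGraph

/-! ### The sentence describing a solution -/

namespace GForm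

open WordGraph

/-- Negation. -/
def neg (φ : GForm) : GForm := imp φ bot

/-- The formula expressing `WordGraph.Equiv` of the variables `i` and `j`. -/
def equiv (i j : ℕ) : GForm := and (adj i i) (and (adj j j) (and (adj i j) (adj j i)))

/-- The formula expressing `WordGraph.Lt` of the variables `i` and `j`. -/
def lt (i j : ℕ) : GForm := and (adj i i) (and (adj j j) (neg (adj j i)))

/-- The formula expressing `WordGraph.Next` of the variables `i` and `j`. -/
def next (i j : ℕ) : GForm := and (lt i j) (all (imp (lt (i + 1) 0) (neg (lt 0 (j + 1)))))

/-- The formula expressing `WordGraph.Marked` of the variable `i`. -/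
def marked (i : ℕ) : GForm := ex (and (adj (i + 1) 0) (all (neg (adj 1 0))))

/-- The formula expressing `WordGraph.Letter b` of the variable `i`. -/
def letter (b : Bool) (i : ℕ) : GForm := if b then marked i else neg (marked i)

/-- The formula expressing `WordGraph.Linked` of the variables `i` and `j`. -/
def linked (i j : ℕ) : GForm :=
  and (adj i i) (and (adj j j)
    (ex (and (neg (adj 0 0)) (and (adj (i + 1) 0) (adj 0 (j + 1))))))

/-- The formula expressing `WordGraph.Last` of the variable `i`. -/
def last (i : ℕ) : GForm := and (adj i i) (all (neg (lt (i + 1) 0)))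

/-- The formula expressing `WordGraph.Path s` of the variables `0` and `j`. Starting at the variable
`0` makes every letter contribute the same piece to the word of the formula. -/
def walkFrom (j : ℕ) : List Bool → GForm
  | [] => equiv 0 j
  | b :: s => ex (and (and (next 1 0) (letter b 1)) (walkFrom (j + 1) s))

/-- The formula expressing that `s` can be read from a vertex equivalent to the variable `i` so as
to arrive at the variable `j`. -/
def walk (i j : ℕ) (s : List Bool) : GForm := ex (and (equiv 0 (i + 1)) (walkFrom (j + 1) s))

/-- The formula expressing `WordGraph.Move c` of the variables `1` and `0`. -/
def move (c : List Bool × List Bool) : GForm :=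
  ex (ex (and (and (walk 3 1 c.1) (walk 2 0 c.2)) (or (linked 1 0) (and (last 1) (last 0)))))

/-- The disjunction of the formulas `move c` over the cards `c` of `R`. -/
def moves (R : Instance) : GForm := R.foldr (fun c φ => or (move c) φ) bot

/-- The sentence expressing transitivity on positions. -/
def transAx : GForm :=
  all (all (all (imp (adj 2 2) (imp (adj 1 1) (imp (adj 0 0)
    (imp (adj 2 1) (imp (adj 1 0) (adj 2 0))))))))

/-- The sentence expressing totality on positions. -/
def totalAx : GForm := all (all (imp (adj 1 1) (imp (adj 0 0) (or (adj 1 0) (adj 0 1)))))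

/-- The sentence expressing that letters respect equivalence. -/
def markedAx : GForm := all (all (imp (equiv 1 0) (imp (marked 1) (marked 0))))

/-- The sentence expressing `WordGraph.Solves`. -/
def solvable (R : Instance) : GForm :=
  and (and transAx (and totalAx markedAx))
    (and (ex (linked 0 0)) (all (all (imp (linked 1 0) (moves R)))))

section sat

variable {D : Type} {E : D → D → Prop} {ρ : ℕ → D}

@[simp] theorem sat_equiv {i j : ℕ} : (equiv i j).Sat E ρ ↔ Equiv E (ρ i) (ρ j) := Iff.rfl

@[simp] theorem sat_next {i j : ℕ} : (next i j).Sat E ρ ↔ Next E (ρ i) (ρ j) := Iff.rfl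

@[simp] theorem sat_letter {b : Bool} {i : ℕ} : (letter b i).Sat E ρ ↔ Letter E b (ρ i) := by
  cases b <;> exact Iff.rfl

@[simp] theorem sat_linked {i j : ℕ} : (linked i j).Sat E ρ ↔ Linked E (ρ i) (ρ j) := Iff.rfl

@[simp] theorem sat_last {i : ℕ} : (last i).Sat E ρ ↔ Last E (ρ i) := Iff.rfl

@[simp] theorem sat_walkFrom {j : ℕ} {s : List Bool} :
    (walkFrom j s).Sat E ρ ↔ WordGraph.Path E s (ρ 0) (ρ j) := by
  induction s generalizing j ρ with
  | nil => exact Iff.rfl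
  | cons b s ih => simp [walkFrom, Sat, WordGraph.Path, ih]

@[simp] theorem sat_move {c : List Bool × List Bool} :
    (move c).Sat E ρ ↔ Move E c (ρ 1) (ρ 0) := by
  simp [move, walk, Sat, Move]

@[simp] theorem sat_moves {R : Instance} :
    (moves R).Sat E ρ ↔ ∃ c ∈ R, Move E c (ρ 1) (ρ 0) := by
  induction R with
  | nil => simp [moves, Sat]
  | cons c R ih =>
    rw [moves] at ih
    simp [moves, Sat, ih]

theorem sat_solvable {R : Instance} : (solvable R).Sat E ρ ↔ Solves E R := by
  constructor
  · rintro ⟨⟨h₁, h₂, h₃⟩, h₄, h₅⟩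
    exact ⟨⟨h₁, h₂, h₃⟩, h₄, fun x y hxy => sat_moves.1 (h₅ x y hxy)⟩
  · rintro ⟨⟨h₁, h₂, h₃⟩, h₄, h₅⟩
    exact ⟨⟨h₁, h₂, h₃⟩, h₄, fun x y hxy => sat_moves.2 (h₅ x y hxy)⟩

end sat

end GForm

/-! ### Computability of the word of the sentence -/

section primrec

variable {S : Signature.{u, v}} (cF : S.Func → ℕ) (cR : S.Rel → ℕ) (A : ℕ → ℕ → Form S)

/-- The word of the formula over `S` that corresponds to `φ`. -/
def GForm.word (φ : GForm) : List ℕ := (φ.toForm A).word cF cR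

/-- The word of the value of `g` is a primitive recursive function. -/
def PrimrecForm {α : Type} [Primcodable α] (g : α → GForm) : Prop :=
  Primrec fun a => (g a).word cF cR A

variable {cF cR A} {α : Type} [Primcodable α] {g h : α → GForm} {i j : α → ℕ}

namespace PrimrecForm

theorem const (φ : GForm) : PrimrecForm cF cR A fun _ : α => φ := Primrec.const _

theorem cons_append (k : ℕ) (hg : PrimrecForm cF cR A g) (hh : PrimrecForm cF cR A h) :
    Primrec fun a => k :: ((g a).word cF cR A ++ (h a).word cF cR A) :=
  Primrec.list_cons.comp (Primrec.const k) (Primrec.list_append.comp hg hh)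

theorem imp (hg : PrimrecForm cF cR A g) (hh : PrimrecForm cF cR A h) :
    PrimrecForm cF cR A fun a => .imp (g a) (h a) := cons_append 2 hg hh

theorem and (hg : PrimrecForm cF cR A g) (hh : PrimrecForm cF cR A h) :
    PrimrecForm cF cR A fun a => .and (g a) (h a) := cons_append 3 hg hh

theorem or (hg : PrimrecForm cF cR A g) (hh : PrimrecForm cF cR A h) :
    PrimrecForm cF cR A fun a => .or (g a) (h a) := cons_append 4 hg hh

theorem all (hg : PrimrecForm cF cR A g) : PrimrecForm cF cR A fun a => .all (g a) :=
  Primrec.list_cons.comp (Primrec.const 5) hg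

theorem ex (hg : PrimrecForm cF cR A g) : PrimrecForm cF cR A fun a => .ex (g a) :=
  Primrec.list_cons.comp (Primrec.const 6) hg

variable (hA : Primrec₂ fun i j => (A i j).word cF cR)
include hA

theorem adj (hi : Primrec i) (hj : Primrec j) :
    PrimrecForm cF cR A fun a => .adj (i a) (j a) := hA.comp hi hj

theorem equiv (hi : Primrec i) (hj : Primrec j) :
    PrimrecForm cF cR A fun a => .equiv (i a) (j a) :=
  (adj hA hi hi).and ((adj hA hj hj).and ((adj hA hi hj).and (adj hA hj hi)))

end PrimrecForm

theorem GForm.word_walkFrom (j : ℕ) (s : List Bool) :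
    (walkFrom j s).word cF cR A =
      (s.flatMap fun b => 6 :: 3 :: (and (next 1 0) (letter b 1)).word cF cR A) ++
        (equiv 0 (j + s.length)).word cF cR A := by
  induction s generalizing j with
  | nil => rfl
  | cons b s ih =>
    have h : (walkFrom j (b :: s)).word cF cR A =
      6 :: 3 :: ((and (next 1 0) (letter b 1)).word cF cR A ++
        (walkFrom (j + 1) s).word cF cR A) := rfl
    rw [h, ih, List.flatMap_cons, List.length_cons, Nat.add_assoc, Nat.add_comm 1]
    simp

namespace PrimrecForm

variable (hA : Primrec₂ fun i j => (A i j).word cF cR)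
include hA

theorem walkFrom (j : ℕ) : PrimrecForm cF cR A (GForm.walkFrom j) := by
  refine (Primrec.list_append.comp (Primrec.list_flatMap Primrec.id ?_)
    (equiv hA (Primrec.const 0)
      (Primrec.nat_add.comp (Primrec.const j) Primrec.list_length))).of_eq
    fun s => (GForm.word_walkFrom j s).symm
  exact (Primrec.dom_bool fun b : Bool =>
    6 :: 3 :: (GForm.and (.next 1 0) (.letter b 1)).word cF cR A).comp Primrec.snd

theorem walk (i j : ℕ) : PrimrecForm cF cR A (GForm.walk i j) :=
  ((const _).and (walkFrom hA (j + 1))).ex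

theorem move : PrimrecForm cF cR A GForm.move := by
  have h₁ : PrimrecForm cF cR A fun c : List Bool × List Bool => GForm.walk 3 1 c.1 :=
    (walk hA 3 1).comp Primrec.fst
  have h₂ : PrimrecForm cF cR A fun c : List Bool × List Bool => GForm.walk 2 0 c.2 :=
    (walk hA 2 0).comp Primrec.snd
  exact ((h₁.and h₂).and (const _)).ex.ex

theorem moves : PrimrecForm cF cR A GForm.moves := by
  have h : Primrec fun R : Instance =>
      R.foldr (fun c l => 4 :: ((GForm.move c).word cF cR A ++ l))
        (GForm.bot.word cF cR A) := by
    refine Primrec.list_foldr (f := fun R : Instance => R)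
      (h := fun _ p => 4 :: ((GForm.move p.1).word cF cR A ++ p.2))
      Primrec.id (Primrec.const _) ?_
    have hm : Primrec fun p : Instance × (List Bool × List Bool) × List ℕ =>
        (GForm.move p.2.1).word cF cR A := (move hA).comp (Primrec.fst.comp Primrec.snd)
    exact Primrec.list_cons.comp (Primrec.const 4)
      (Primrec.list_append.comp hm (Primrec.snd.comp Primrec.snd))
  refine h.of_eq fun R => ?_
  induction R with
  | nil => rfl
  | cons c R ih => rw [List.foldr_cons, ih]; rfl

theorem solvable : PrimrecForm cF cR A GForm.solvable :=
  (const _).and ((const _).and ((const _).imp (moves hA)).all.all)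

end PrimrecForm

end primrec

/-! ### Atoms expressing a binary relation -/

section atoms

variable {S : Signature.{u, v}}

/-- The reduction to `FSAT S`, given formulas `A i j` over `S` that express an arbitrary binary
relation. -/
theorem reducesTo_of_atom (A : ℕ → ℕ → Form S) {F : Set S.Func} {G : Set S.Rel} (hF : F.Finite)
    (hG : G.Finite) (hAF : ∀ i j, (A i j).funcs ⊆ F) (hAG : ∀ i j, (A i j).rels ⊆ G)
    (hA : ∀ cF cR, Primrec₂ fun i j => (A i j).word cF cR)
    (rel : ∀ (D : Type) (M : Model S D), ∃ E : D → D → Prop,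
      ∀ ρ i j, (A i j).Sat M ρ ↔ E (ρ i) (ρ j))
    (model : ∀ (D : Type) (E : D → D → Prop), Nontrivial D → ∃ M : Model S D,
      ∀ ρ i j, (A i j).Sat M ρ ↔ E (ρ i) (ρ j)) :
    ReducesTo BPCP (FSAT S) := by
  refine ⟨fun R => (GForm.solvable R).toForm A,
    ⟨hF.subset (Set.iUnion_subset fun R => GForm.funcs_toForm hAF _),
      hG.subset (Set.iUnion_subset fun R => GForm.rels_toForm hAG _),
      fun cF cR => (PrimrecForm.solvable (hA cF cR)).to_comp⟩, fun R => ⟨?_, ?_⟩⟩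
  · rintro ⟨w, hw⟩
    obtain ⟨M, hM⟩ := model (WordGraph.Vertex w) (WordGraph.edge R w)
      ⟨.inl 0, .inr none, Sum.inl_ne_inr⟩
    exact ⟨_, inferInstance, M, fun _ => .inr none,
      (GForm.sat_toForm hM _ _).2 (GForm.sat_solvable.2 (WordGraph.solves_edge hw))⟩
  · rintro ⟨D, _, M, ρ, h⟩
    obtain ⟨E, hE⟩ := rel D M
    exact (GForm.sat_solvable.1 ((GForm.sat_toForm hE _ _).1 h)).bpcp

/-- The argument tuple `(x, y, …, y)`. -/
def pairArgs {X : Type*} {n : ℕ} (x y : X) (k : Fin n) : X := if (k : ℕ) = 0 then x else y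

theorem eval_pairArgs {D : Type} {M : Model S D} {ρ : ℕ → D} {n : ℕ} (i j : ℕ) :
    (fun k : Fin n => (pairArgs (Term.var i) (Term.var j) k : Term S).eval M ρ) =
      pairArgs (ρ i) (ρ j) := by
  funext k
  unfold pairArgs
  split_ifs <;> rfl

theorem funcs_pairArgs {n : ℕ} (i j : ℕ) (k : Fin n) :
    (pairArgs (Term.var i) (Term.var j) k : Term S).funcs = ∅ := by
  unfold pairArgs
  split_ifs <;> rfl

theorem primrec_word_pairArgs (cF : S.Func → ℕ) (n : ℕ) :
    Primrec fun p : ℕ × ℕ => (List.ofFn fun k : Fin n =>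
      (pairArgs (Term.var p.1) (Term.var p.2) k : Term S).word cF).flatten := by
  refine Primrec.list_flatten.comp (Primrec.list_ofFn fun k => ?_)
  have h : ∀ {f : ℕ × ℕ → ℕ}, Primrec f → Primrec fun p => [0, f p] := fun hf =>
    Primrec.list_cons.comp (Primrec.const 0) (Primrec.list_cons.comp hf (Primrec.const []))
  by_cases hk : (k : ℕ) = 0
  · simpa [pairArgs, hk, Term.word] using h Primrec.fst
  · simpa [pairArgs, hk, Term.word] using h Primrec.snd

theorem reducesTo_of_rel {P : S.Rel} (hP : 2 ≤ S.arR P) : ReducesTo BPCP (FSAT S) := by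
  refine reducesTo_of_atom (fun i j => .rel P (pairArgs (.var i) (.var j))) Set.finite_empty
    (Set.finite_singleton P) (fun i j => by simp [Form.funcs, funcs_pairArgs])
    (fun i j => subset_rfl) (fun cF cR => ?_) (fun D M => ?_) (fun D E _ => ?_)
  · exact Primrec.list_cons.comp (Primrec.const 1)
      (Primrec.list_cons.comp (Primrec.const (cR P)) (primrec_word_pairArgs cF _))
  · exact ⟨fun x y => M.rel P (pairArgs x y), fun ρ i j => by rw [Form.Sat, eval_pairArgs]⟩
  · obtain ⟨d⟩ : Nonempty D := inferInstance
    refine ⟨⟨fun _ _ => d, fun P' a => ∃ h : 2 ≤ S.arR P', E (a ⟨0, by omega⟩) (a ⟨1, by omega⟩)⟩,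
      fun ρ i j => ?_⟩
    rw [Form.Sat, eval_pairArgs]
    simp [pairArgs, hP]

theorem reducesTo_of_rel_of_func {Q : S.Rel} (hQ : S.arR Q = 1) {f : S.Func} (hf : 2 ≤ S.arF f) :
    ReducesTo BPCP (FSAT S) := by
  refine reducesTo_of_atom (fun i j => .rel Q fun _ => .app f (pairArgs (.var i) (.var j)))
    (Set.finite_singleton f) (Set.finite_singleton Q)
    (fun i j => by simp [Form.funcs, Term.funcs, funcs_pairArgs])
    (fun i j => subset_rfl) (fun cF cR => ?_) (fun D M => ?_) (fun D E _ => ?_)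
  · exact Primrec.list_cons.comp (Primrec.const 1)
      (Primrec.list_cons.comp (Primrec.const (cR Q)) (Primrec.list_flatten.comp
        (Primrec.list_ofFn fun _ => Primrec.list_cons.comp (Primrec.const 1)
          (Primrec.list_cons.comp (Primrec.const (cF f)) (primrec_word_pairArgs cF _)))))
  · exact ⟨fun x y => M.rel Q fun _ => M.func f (pairArgs x y), fun ρ i j => by
      simp only [Form.Sat, Term.eval, eval_pairArgs]⟩
  · classical
    obtain ⟨d, e, hde⟩ := exists_pair_ne D
    refine ⟨⟨fun f' a => if ∃ h : 2 ≤ S.arF f', E (a ⟨0, by omega⟩) (a ⟨1, by omega⟩) then d else e,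
      fun _ a => ∀ k, a k = d⟩, fun ρ i j => ?_⟩
    have : Nonempty (Fin (S.arR Q)) := ⟨⟨0, by omega⟩⟩
    simp only [Form.Sat, Term.eval, forall_const]
    simp [pairArgs, hf, hde.symm, Term.eval]

end atoms

end Trakhtenbrot

theorem theorem6p3 (S : Trakhtenbrot.Signature.{u, v})
    (hS : (∃ P : S.Rel, 2 ≤ S.arR P) ∨
      ((∃ Q : S.Rel, S.arR Q = 1) ∧ ∃ f : S.Func, 2 ≤ S.arF f)) :
    Trakhtenbrot.ReducesTo Trakhtenbrot.BPCP (Trakhtenbrot.FSAT S) := by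
  rcases hS with ⟨P, hP⟩ | ⟨⟨Q, hQ⟩, f, hf⟩
  · exact Trakhtenbrot.reducesTo_of_rel hP
  · exact Trakhtenbrot.reducesTo_of_rel_of_func hQ hf
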